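/- Let $X=[0,\infty)$ with the usual metric $d(x,y)=|x-y|$ and base point $0$. Call a (not necessarily continuous) function $s:(0,\infty)\to(0,\infty)$ asymptotically subpower (resp. asymptotically sublinear) if for every $\alpha>0$ there is $t_0>0$ such that $s(t)<t^{\alpha}$ (resp. $s(t)<\alpha t$) for all $t>t_0$. Let $\mathcal H$, $\mathcal P$, $\mathcal L$ be the sets of positive constant functions, of asymptotically subpower functions and of asymptotically sublinear functions, respectively. For $A\in\{H,P,L\}$, with corresponding class $\mathcal A\in\{\mathcal H,\mathcal P,\mathcal L\}$, let $C_A(X)$ be the set of bounded continuous functions $f:X\to\mathbb R$ such that $$\lim_{x\to\infty}\operatorname{diam} f\bigl(B(x,s(x))\bigr)=0\quad\text{for every } s\in\mathcal A,$$ where $B(x,r)$ denotes the closed ball in $X$. Let $e_A:X\to\prod_{f\in C_A(X)}[\inf f,\sup f]$, $e_A(x)=(f(x))_f$, be the evaluation map. The Higson type compactification $h_A(X)$ is the closure of $e_A(X)$ in this product, and, identifying $X$ with $e_A(X)$, its corona is $\nu_A X=h_A(X)\setminus X$. Then for each $A\in\{H,P,L\}$ there exists a continuous surjection $\xi_A:\nu_P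 X\to h_A(X)$ from the subpower Higson corona $\nu_P X$ onto the Higson type compactification $h_A(X)$. -/

import Mathlib

open scoped NNReal BoundedContinuousFunction

namespace Higson

/-- A function `s` on the positive reals with positive values such that for every `α > 0`
eventually `s t < t ^ α`. (The values of `s` outside the positive reals are irrelevant.) -/
def IsAsympSubpower (s : ℝ → ℝ) : Prop :=
  (∀ t, 0 < t → 0 < s t) ∧
    ∀ α : ℝ, 0 < α → ∃ t₀ : ℝ, 0 < t₀ ∧ ∀ t, t₀ < t → s t < t ^ α

/-- A function `s` on the positive reals with positive values such that for every `α > 0`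
eventually `s t < α * t`. -/
def IsAsympSublinear (s : ℝ → ℝ) : Prop :=
  (∀ t, 0 < t → 0 < s t) ∧
    ∀ α : ℝ, 0 < α → ∃ t₀ : ℝ, 0 < t₀ ∧ ∀ t, t₀ < t → s t < α * t

/-- The three types of compactification: Higson, subpower Higson, sublinear Higson. -/
inductive Kind where
  | H : Kind
  | P : Kind
  | L : Kind

/-- The class of control functions: positive constants, asymptotically subpower functions,
asymptotically sublinear functions, respectively. -/
def Kind.gauges : Kind → Set (ℝ → ℝ)
  | .H => {s | ∃ c : ℝ, 0 < c ∧ s = fun _ => c}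
  | .P => {s | IsAsympSubpower s}
  | .L => {s | IsAsympSublinear s}

/-- `diam f (B (x, s |x|)) → 0` as `|x| → ∞`, where `|x| = dist x₀ x` and `B` is the closed ball.
As `f` is bounded, the diameters are diameters of bounded sets. -/
def DiamVanishes {X : Type*} [MetricSpace X] (x₀ : X) (f : X →ᵇ ℝ) (s : ℝ → ℝ) : Prop :=
  Filter.Tendsto (fun x : X => Metric.diam (f '' Metric.closedBall x (s (dist x₀ x))))
    (Filter.comap (fun x : X => dist x₀ x) Filter.atTop) (nhds 0)

/-- The ring `C_A(X)`, as a set of bounded continuous real-valued functions. -/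
def functions (A : Kind) (X : Type*) [MetricSpace X] (x₀ : X) : Set (X →ᵇ ℝ) :=
  {f | ∀ s ∈ A.gauges, DiamVanishes x₀ f s}

/-- The interval `I_f = [inf f, sup f]`. -/
abbrev rangeInterval {X : Type*} [MetricSpace X] (f : X →ᵇ ℝ) : Set ℝ :=
  Set.Icc (⨅ x, f x) (⨆ x, f x)

theorem apply_mem_rangeInterval {X : Type*} [MetricSpace X] (f : X →ᵇ ℝ) (x : X) :
    f x ∈ rangeInterval f :=
  ⟨ciInf_le f.isBounded_range.bddBelow x, le_ciSup f.isBounded_range.bddAbove x⟩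

/-- The evaluation map `e_F : X → ∏_{f ∈ F} I_f`; the target has the product topology. -/
def evalMap {X : Type*} [MetricSpace X] (F : Set (X →ᵇ ℝ)) (x : X) :
    (f : F) → rangeInterval (f : X →ᵇ ℝ) :=
  fun f => ⟨(f : X →ᵇ ℝ) x, apply_mem_rangeInterval (f : X →ᵇ ℝ) x⟩

/-- The compactification `h_A(X)`: the closure of `e_F(X)` in `∏_{f ∈ F} I_f`, `F = C_A(X)`. -/
def compactification (A : Kind) (X : Type*) [MetricSpace X] (x₀ : X) :
    Set ((f : functions A X x₀) → rangeInterval (f : X →ᵇ ℝ)) :=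
  closure (Set.range (evalMap (functions A X x₀)))

/-- The corona `ν_A X = h_A(X) \ X`, where `X` is identified with `e_F(X)`. -/
def corona (A : Kind) (X : Type*) [MetricSpace X] (x₀ : X) :
    Set ((f : functions A X x₀) → rangeInterval (f : X →ᵇ ℝ)) :=
  compactification A X x₀ \ Set.range (evalMap (functions A X x₀))

end Higson

/-!
Put `t = √(1 + x)`. A subpower gauge satisfies `s x < x ^ (1/4)` for large `x`, and so `t` changes by
at most `x ^ (1/4) / √x → 0` on the ball `B(x, s x)`. Hence every bounded continuous function that is
uniformly continuous in the variable `t` belongs to `C_P` (`mem_functions_of_scale`). On the other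
hand every function in `C_A` is uniformly continuous, because `C_A ⊆ C_H`
(`uniformContinuous_of_mem_functions`).

The map `g x = w |sin w|` with `w = √t` is `1`-Lipschitz in `t` (`dist_zigzag_le`), and so
`f ↦ f ∘ g` maps `C_A` into `C_P` (`compZigzag`). On the products it induces a continuous map `h_P → h_A`
extending `g`. This map is onto already on the corona, since `g` takes every value on every
neighbourhood of infinity (`exists_zigzag_eq`): if `q` in `h_A` is the limit of `e_A` along a filter
`l` on `X`, then `comap g l ⊓ atTop` is a proper filter, and a limit of `e_P` along an ultrafilter
finer than it is sent to `q`. Such a limit lies off `X`, because the function `1 / t` in `C_P` is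
positive on `X` and tends to `0` at infinity.
-/

open Filter Topology

namespace Higson

/-! ### The square root scale -/

/-- The change of variable `x ↦ √(1 + x)`. The shift by `1` keeps the values in `[1, ∞)`, where
`√` and inversion are Lipschitz. -/
noncomputable def scale (x : ℝ≥0) : ℝ := √(1 + x)

theorem one_le_scale (x : ℝ≥0) : 1 ≤ scale x := by
  rw [scale, Real.one_le_sqrt]
  simp

theorem continuous_scale : Continuous scale := by
  unfold scale
  fun_prop

theorem tendsto_scale_atTop : Tendsto scale atTop atTop :=
  Real.tendsto_sqrt_atTop.comp
    (tendsto_atTop_add_const_left _ _ (NNReal.tendsto_coe_atTop.2 tendsto_id))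

theorem abs_scale_sub_mul_sqrt_le (x y : ℝ≥0) :
    |scale x - scale y| * √(x : ℝ) ≤ |(x : ℝ) - y| := by
  have hx := Real.sq_sqrt (show (0 : ℝ) ≤ 1 + x by positivity)
  have hy := Real.sq_sqrt (show (0 : ℝ) ≤ 1 + y by positivity)
  have h : (x : ℝ) - y = (scale x - scale y) * (scale x + scale y) := by
    unfold scale
    linear_combination hy - hx
  have h0 : 0 ≤ scale x + scale y := by linarith [one_le_scale x, one_le_scale y]
  rw [h, abs_mul, abs_of_nonneg h0]
  gcongr
  have : √(x : ℝ) ≤ scale x := Real.sqrt_le_sqrt (by linarith)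
  linarith [one_le_scale y]

theorem comap_dist_zero_atTop :
    comap (fun x : ℝ≥0 => dist (0 : ℝ≥0) x) atTop = (atTop : Filter ℝ≥0) := by
  have : (fun x : ℝ≥0 => dist (0 : ℝ≥0) x) = ((↑) : ℝ≥0 → ℝ) := by
    funext x
    simp [NNReal.dist_eq]
  rw [this, NNReal.comap_coe_atTop]

/-- On the balls prescribed by a subpower gauge, the square root scale varies less and less. -/
theorem IsAsympSubpower.eventually_scale {s : ℝ → ℝ} (hs : IsAsympSubpower s) {δ : ℝ}
    (hδ : 0 < δ) :
    ∀ᶠ x : ℝ≥0 in atTop, ∀ y, dist y x ≤ s (dist 0 x) → |scale x - scale y| < δ := by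
  obtain ⟨t₀, -, ht⟩ := hs.2 (1 / 4) (by norm_num)
  have hlim : Tendsto (fun x : ℝ≥0 => (x : ℝ) ^ (-(1 / 4) : ℝ)) atTop (𝓝 0) :=
    (tendsto_rpow_neg_atTop (by norm_num)).comp (NNReal.tendsto_coe_atTop.2 tendsto_id)
  have hcoe : Tendsto (fun x : ℝ≥0 => (x : ℝ)) atTop atTop := NNReal.tendsto_coe_atTop.2 tendsto_id
  filter_upwards [hlim.eventually_lt_const hδ, hcoe.eventually_gt_atTop t₀,
    hcoe.eventually_gt_atTop 0] with x hxδ hxt hx0 y hy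
  have hd : dist (0 : ℝ≥0) x = x := by simp [NNReal.dist_eq]
  rw [hd, dist_comm, NNReal.dist_eq] at hy
  have hsqrt : 0 < √(x : ℝ) := Real.sqrt_pos.2 hx0
  refine lt_of_mul_lt_mul_right ?_ hsqrt.le
  calc |scale x - scale y| * √(x : ℝ) ≤ |(x : ℝ) - y| := abs_scale_sub_mul_sqrt_le x y
    _ < (x : ℝ) ^ (1 / 4 : ℝ) := hy.trans_lt (ht _ hxt)
    _ = (x : ℝ) ^ (-(1 / 4) : ℝ) * √(x : ℝ) := by
      rw [Real.sqrt_eq_rpow, ← Real.rpow_add hx0]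
      norm_num
    _ < δ * √(x : ℝ) := by gcongr

/-- A bounded continuous function that is uniformly continuous in the square root scale belongs to
`C_P`. -/
theorem mem_functions_of_scale {F : ℝ≥0 →ᵇ ℝ}
    (hF : ∀ ε > 0, ∃ δ > 0, ∀ x y, |scale x - scale y| < δ → |F x - F y| < ε) :
    F ∈ functions Kind.P ℝ≥0 0 := by
  intro s hs
  rw [DiamVanishes, comap_dist_zero_atTop, Metric.tendsto_nhds]
  intro ε hε
  obtain ⟨δ, hδ, h⟩ := hF (ε / 4) (by positivity)
  filter_upwards [IsAsympSubpower.eventually_scale hs hδ] with x hx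
  rw [Real.dist_0_eq_abs, abs_of_nonneg Metric.diam_nonneg]
  refine (Metric.diam_le_of_forall_dist_le (C := ε / 2) (by positivity) ?_).trans_lt (by linarith)
  rintro _ ⟨y, hy, rfl⟩ _ ⟨z, hz, rfl⟩
  have h₁ := h x y (hx y hy)
  have h₂ := h x z (hx z hz)
  rw [Real.dist_eq]
  rw [abs_lt] at h₁ h₂
  rw [abs_le]
  constructor <;> linarith [h₁.1, h₁.2, h₂.1, h₂.2]

/-! ### Uniform continuity of the functions in `C_A` -/

theorem const_mem_gauges (A : Kind) {c : ℝ} (hc : 0 < c) : (fun _ => c) ∈ A.gauges := by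
  cases A with
  | H => exact ⟨c, hc, rfl⟩
  | P =>
    refine ⟨fun _ _ => hc, fun α hα => ?_⟩
    obtain ⟨T, hT⟩ := eventually_atTop.1 ((tendsto_rpow_atTop hα).eventually_gt_atTop c)
    exact ⟨max T 1, by positivity, fun t ht => hT t ((le_max_left _ _).trans ht.le)⟩
  | L =>
    refine ⟨fun _ _ => hc, fun α hα => ⟨c / α, by positivity, fun t ht => ?_⟩⟩
    rwa [div_lt_iff₀' hα] at ht

theorem uniformContinuous_of_mem_functions {A : Kind} {f : ℝ≥0 →ᵇ ℝ}
    (hf : f ∈ functions A ℝ≥0 0) : UniformContinuous f := by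
  rw [Metric.uniformContinuous_iff]
  intro ε hε
  have hlim := hf _ (const_mem_gauges A one_pos)
  rw [DiamVanishes, comap_dist_zero_atTop] at hlim
  obtain ⟨R, hR⟩ := eventually_atTop.1 (hlim.eventually_lt_const hε)
  have hcpt := (isCompact_Icc (a := (0 : ℝ≥0)) (b := R + 1)).uniformContinuousOn_of_continuous
    f.continuous.continuousOn
  obtain ⟨δ, hδ, h⟩ := Metric.uniformContinuousOn_iff.1 hcpt ε hε
  refine ⟨min δ 1, by positivity, fun {x y} hxy => ?_⟩
  by_cases hx : R ≤ x
  · have hyx : y ∈ Metric.closedBall x 1 := by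
      rw [Metric.mem_closedBall, dist_comm]
      exact (hxy.trans_le (min_le_right _ _)).le
    exact (Metric.dist_le_diam_of_mem (f.isBounded_range.subset (Set.image_subset_range _ _))
      (Set.mem_image_of_mem f (Metric.mem_closedBall_self zero_le_one))
      (Set.mem_image_of_mem f hyx)).trans_lt (hR x hx)
  · have hy : (y : ℝ) ≤ R + 1 := by
      have h₁ := (hxy.trans_le (min_le_right _ _))
      rw [NNReal.dist_eq, abs_lt] at h₁
      have : (x : ℝ) < R := by exact_mod_cast not_le.1 hx
      linarith [h₁.1]
    refine h x ⟨zero_le, (not_le.1 hx).le.trans (by simp)⟩ y ⟨zero_le, ?_⟩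
      (hxy.trans_le (min_le_left _ _))
    exact_mod_cast hy

/-! ### A slow map attaining every value near infinity -/

/-- The map `x ↦ w |sin w|` with `w = √√(1 + x)`: it is Lipschitz in the square root scale, and
oscillates between `0` and arbitrarily large values. -/
noncomputable def zigzag (x : ℝ≥0) : ℝ≥0 :=
  ⟨√(scale x) * |Real.sin √(scale x)|, by positivity⟩

theorem continuous_zigzag : Continuous zigzag := by
  have := continuous_scale
  exact Continuous.subtype_mk (by fun_prop) _

/-- The slope of `w |sin w|` grows like `w`, as does that of `w ^ 2`. -/
theorem abs_mul_abs_sin_sub_le {a b : ℝ} (ha : 1 ≤ a) (hb : 1 ≤ b) :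
    abs (a * |Real.sin a| - b * |Real.sin b|) ≤ |a ^ 2 - b ^ 2| := by
  have hsub : abs (|Real.sin a| - |Real.sin b|) ≤ |a - b| :=
    (abs_abs_sub_abs_le _ _).trans (by simpa using Real.abs_sin_sub_sin_le a b)
  have h1 : |Real.sin a| ≤ 1 := Real.abs_sin_le_one a
  calc abs (a * |Real.sin a| - b * |Real.sin b|)
      = abs ((a - b) * |Real.sin a| + b * (|Real.sin a| - |Real.sin b|)) := by ring_nf
    _ ≤ abs ((a - b) * |Real.sin a|) + abs (b * (|Real.sin a| - |Real.sin b|)) := abs_add_le _ _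
    _ = |a - b| * |Real.sin a| + b * abs (|Real.sin a| - |Real.sin b|) := by
      rw [abs_mul, abs_mul, abs_abs, abs_of_nonneg (by linarith : 0 ≤ b)]
    _ ≤ |a - b| * a + b * |a - b| := by
      gcongr
      linarith
    _ = |a ^ 2 - b ^ 2| := by
      rw [show a ^ 2 - b ^ 2 = (a - b) * (a + b) by ring, abs_mul,
        abs_of_nonneg (by linarith : 0 ≤ a + b)]
      ring

theorem dist_zigzag_le (x y : ℝ≥0) : dist (zigzag x) (zigzag y) ≤ |scale x - scale y| := by
  have h := abs_mul_abs_sin_sub_le (Real.one_le_sqrt.2 (one_le_scale x))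
    (Real.one_le_sqrt.2 (one_le_scale y))
  rwa [Real.sq_sqrt (by linarith [one_le_scale x]), Real.sq_sqrt (by linarith [one_le_scale y])]
    at h

/-- By the intermediate value theorem in `w` on `[kπ, kπ + π/2]`, where `w |sin w|` runs from `0` to
`kπ + π/2`. -/
theorem exists_zigzag_eq (y N : ℝ≥0) : ∃ x, N ≤ x ∧ zigzag x = y := by
  obtain ⟨k, hk⟩ := exists_nat_ge ((y : ℝ) + N + 1)
  have hkπ : (k : ℝ) ≤ k * Real.pi :=
    le_mul_of_one_le_right (by positivity) (by linarith [Real.pi_gt_three])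
  have hy := y.coe_nonneg
  have hN := N.coe_nonneg
  have hπ := Real.pi_pos
  have hivt := intermediate_value_Icc (a := k * Real.pi) (b := k * Real.pi + Real.pi / 2)
    (f := fun w => w * |Real.sin w|) (by linarith) (by fun_prop)
  have hend : |Real.sin (k * Real.pi + Real.pi / 2)| = 1 := by
    rw [Real.sin_add_pi_div_two, Real.cos_nat_mul_pi, abs_pow, abs_neg, abs_one, one_pow]
  obtain ⟨w, ⟨hw, -⟩, hwy⟩ := hivt (show (y : ℝ) ∈ _ by
    simp only [Real.sin_nat_mul_pi, abs_zero, mul_zero, hend, mul_one]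
    exact ⟨hy, by linarith⟩)
  have hw1 : (N : ℝ) + 1 ≤ w := by linarith
  have hw4 : (N : ℝ) + 1 ≤ w ^ 4 := hw1.trans (le_self_pow₀ (by linarith) (by norm_num))
  refine ⟨⟨w ^ 4 - 1, by linarith⟩, NNReal.coe_le_coe.1 ?_, NNReal.coe_injective ?_⟩
  · change (N : ℝ) ≤ w ^ 4 - 1
    linarith
  · have hroot : √(scale ⟨w ^ 4 - 1, by linarith⟩) = w := by
      have : 1 + (w ^ 4 - 1) = (w ^ 2) ^ 2 := by ring
      change √√(1 + (w ^ 4 - 1)) = w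
      rw [this, Real.sqrt_sq (by positivity), Real.sqrt_sq (by linarith)]
    change √(scale _) * |Real.sin √(scale _)| = y
    rw [hroot]
    exact hwy

/-- The substitution `C_A → C_P`, `f ↦ f ∘ zigzag`. -/
noncomputable def compZigzag {A : Kind} (f : functions A ℝ≥0 0) : functions Kind.P ℝ≥0 0 :=
  ⟨f.1.compContinuous ⟨zigzag, continuous_zigzag⟩, mem_functions_of_scale fun ε hε => by
    obtain ⟨δ, hδ, h⟩ :=
      Metric.uniformContinuous_iff.1 (uniformContinuous_of_mem_functions f.2) ε hε
    exact ⟨δ, hδ, fun x y hxy => h ((dist_zigzag_le x y).trans_lt hxy)⟩⟩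

theorem rangeInterval_compZigzag_subset {A : Kind} (f : functions A ℝ≥0 0) :
    rangeInterval (compZigzag f : ℝ≥0 →ᵇ ℝ) ⊆ rangeInterval (f : ℝ≥0 →ᵇ ℝ) :=
  Set.Icc_subset_Icc (le_ciInf fun x => (apply_mem_rangeInterval f.1 (zigzag x)).1)
    (ciSup_le fun x => (apply_mem_rangeInterval f.1 (zigzag x)).2)

/-! ### Points of the subpower corona -/

/-- The function `x ↦ 1 / √(1 + x)`. Its limit at infinity is `0`, a value it does not take, and so
it separates `X` from the limits of `e_P` at infinity. -/
noncomputable def invScale : ℝ≥0 →ᵇ ℝ :=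
  BoundedContinuousFunction.ofNormedAddCommGroup (fun x => (scale x)⁻¹)
    (continuous_scale.inv₀ fun x => by linarith [one_le_scale x]) 1 fun x => by
      rw [Real.norm_eq_abs, abs_of_pos (inv_pos.2 (one_pos.trans_le (one_le_scale x)))]
      exact inv_le_one_of_one_le₀ (one_le_scale x)

theorem invScale_pos (x : ℝ≥0) : 0 < invScale x :=
  inv_pos.2 (one_pos.trans_le (one_le_scale x))

theorem tendsto_invScale : Tendsto invScale atTop (𝓝 0) :=
  tendsto_inv_atTop_zero.comp tendsto_scale_atTop

theorem invScale_mem_functions : invScale ∈ functions Kind.P ℝ≥0 0 := by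
  refine mem_functions_of_scale fun ε hε => ⟨ε, hε, fun x y hxy => lt_of_le_of_lt ?_ hxy⟩
  have hx := one_le_scale x
  have hy := one_le_scale y
  change |(scale x)⁻¹ - (scale y)⁻¹| ≤ _
  rw [inv_sub_inv (by linarith) (by linarith), abs_div, abs_sub_comm]
  refine div_le_self (abs_nonneg _) ?_
  rw [abs_of_nonneg (by positivity)]
  exact one_le_mul_of_one_le_of_one_le hx hy

/-- Limits of `e_P` at infinity lie in the corona. -/
theorem mem_corona_of_tendsto {G : Filter ℝ≥0} [G.NeBot] (hG : G ≤ atTop)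
    {p : (f : functions Kind.P ℝ≥0 0) → rangeInterval (f : ℝ≥0 →ᵇ ℝ)}
    (hp : Tendsto (evalMap (functions Kind.P ℝ≥0 0)) G (𝓝 p)) : p ∈ corona Kind.P ℝ≥0 0 := by
  refine ⟨mem_closure_of_tendsto hp (Eventually.of_forall fun x => ⟨x, rfl⟩), ?_⟩
  rintro ⟨x, rfl⟩
  have h : Tendsto invScale G (𝓝 (invScale x)) :=
    (continuous_subtype_val.tendsto _).comp
      (tendsto_pi_nhds.1 hp ⟨invScale, invScale_mem_functions⟩)
  exact (invScale_pos x).ne' (tendsto_nhds_unique h (tendsto_invScale.mono_left hG))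

/-! ### The map induced on the products -/

/-- The map of products that substitutes `zigzag`: its coordinate at `f` is the coordinate at
`f ∘ zigzag`, whose interval is contained in that of `f`. -/
noncomputable def zigzagPullback (A : Kind)
    (p : (f : functions Kind.P ℝ≥0 0) → rangeInterval (f : ℝ≥0 →ᵇ ℝ)) :
    (f : functions A ℝ≥0 0) → rangeInterval (f : ℝ≥0 →ᵇ ℝ) := fun f =>
  Set.inclusion (rangeInterval_compZigzag_subset f) (p (compZigzag f))

theorem continuous_zigzagPullback (A : Kind) : Continuous (zigzagPullback A) :=
  continuous_pi fun _ => (continuous_inclusion _).comp (continuous_apply _)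

theorem zigzagPullback_evalMap (A : Kind) (x : ℝ≥0) :
    zigzagPullback A (evalMap (functions Kind.P ℝ≥0 0) x) =
      evalMap (functions A ℝ≥0 0) (zigzag x) :=
  rfl

theorem zigzagPullback_mem_compactification {A : Kind}
    {p : (f : functions Kind.P ℝ≥0 0) → rangeInterval (f : ℝ≥0 →ᵇ ℝ)}
    (hp : p ∈ compactification Kind.P ℝ≥0 0) :
    zigzagPullback A p ∈ compactification A ℝ≥0 0 := by
  refine map_mem_closure (continuous_zigzagPullback A) hp ?_
  rintro _ ⟨x, rfl⟩
  exact ⟨zigzag x, (zigzagPullback_evalMap A x).symm⟩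

/-- The corona, and not only the whole compactification, is mapped onto `h_A`, because `zigzag`
attains every value at points tending to infinity. -/
theorem exists_mem_corona_zigzagPullback_eq {A : Kind}
    {q : (f : functions A ℝ≥0 0) → rangeInterval (f : ℝ≥0 →ᵇ ℝ)}
    (hq : q ∈ compactification A ℝ≥0 0) :
    ∃ p ∈ corona Kind.P ℝ≥0 0, zigzagPullback A p = q := by
  set l : Filter ℝ≥0 := comap (evalMap (functions A ℝ≥0 0)) (𝓝 q)
  have hl : l.NeBot := comap_neBot_iff.2 fun U hU => by
    obtain ⟨_, hxU, x, rfl⟩ := mem_closure_iff_nhds.1 hq U hU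
    exact ⟨x, hxU⟩
  have hne : (comap zigzag l ⊓ atTop).NeBot := by
    rw [inf_neBot_iff]
    rintro S ⟨U, hU, hUS⟩ T hT
    obtain ⟨y, hy⟩ := hl.nonempty_of_mem hU
    obtain ⟨N, hN⟩ := mem_atTop_sets.1 hT
    obtain ⟨x, hNx, rfl⟩ := exists_zigzag_eq y N
    exact ⟨x, hUS hy, hN x hNx⟩
  let G : Ultrafilter ℝ≥0 := Ultrafilter.of (comap zigzag l ⊓ atTop)
  have hG : (G : Filter ℝ≥0) ≤ comap zigzag l ⊓ atTop := Ultrafilter.of_le _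
  -- The product of the intervals is compact, so `e_P` converges along every ultrafilter.
  obtain ⟨p, -, hp⟩ := isCompact_univ.ultrafilter_le_nhds
    (G.map (evalMap (functions Kind.P ℝ≥0 0))) (by simp)
  have hp' : Tendsto (evalMap (functions Kind.P ℝ≥0 0)) G (𝓝 p) := hp
  refine ⟨p, mem_corona_of_tendsto (hG.trans inf_le_right) hp', ?_⟩
  have h₁ : Tendsto (fun x => evalMap (functions A ℝ≥0 0) (zigzag x)) G
      (𝓝 (zigzagPullback A p)) := ((continuous_zigzagPullback A).tendsto p).comp hp'
  have h₂ : Tendsto (fun x => evalMap (functions A ℝ≥0 0) (zigzag x)) G (𝓝 q) :=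
    tendsto_comap.comp (tendsto_comap.mono_left (hG.trans inf_le_left))
  exact tendsto_nhds_unique h₁ h₂

end Higson

theorem theorem3p6 (A : Higson.Kind) :
    ∃ ξ : Higson.corona Higson.Kind.P ℝ≥0 0 → Higson.compactification A ℝ≥0 0,
      Continuous ξ ∧ Function.Surjective ξ := by
  refine ⟨fun p => ⟨Higson.zigzagPullback A p, Higson.zigzagPullback_mem_compactification p.2.1⟩,
    ((Higson.continuous_zigzagPullback A).comp continuous_subtype_val).subtype_mk _, fun q => ?_⟩
  obtain ⟨p, hp, hpq⟩ := Higson.exists_mem_corona_zigzagPullback_eq q.2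
  exact ⟨⟨p, hp⟩, Subtype.ext hpq⟩
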